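/- Let $\mathcal H$ be a complex Hilbert space, let $n\ge 1$, and let $\mathbb F_n^+$ be the unital free semigroup on $g_1,\dots,g_n$ with identity $g_0$ and word length $|\alpha|$. For a Hilbert space $\mathcal X$ put $$[B(\mathcal X)^n]_{<1}:=\{(X_1,\dots,X_n)\in B(\mathcal X)^n:\ \|X_1X_1^*+\cdots+X_nX_n^*\|<1\},$$ and write $X_\alpha:=X_{i_1}\cdots X_{i_k}$ if $\alpha=g_{i_1}\cdots g_{i_k}$, $X_{g_0}:=I$. Let $\mathcal A=\{A_{(\alpha)}\}_{\alpha\in\mathbb F_n^+}$ and $\mathcal B=\{B_{(\alpha)}\}_{\alpha\in\mathbb F_n^+}$ be families in $B(\mathcal H)$, and write $A_{(0)}:=A_{(g_0)}$, $B_{(0)}:=B_{(g_0)}$. Assume that $A_{(0)}$ and $B_{(0)}$ are selfadjoint and that the series $$F_{\mathcal A}(X_1,\dots,X_n)=\tfrac12 I\otimes A_{(0)}+\sum_{k=1}^\infty\sum_{|\alpha|=k}X_\alpha\otimes A_{(\alpha)}$$ and the analogous series $F_{\mathcal B}$ converge in the operator norm of $B(\mathcal X\otimes\mathcal H)$ for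 every Hilbert space $\mathcal X$ and every $(X_1,\dots,X_n)\in[B(\mathcal X)^n]_{<1}$. Let $H_{\mathcal A}:=\operatorname{Re}F_{\mathcal A}=\frac12(F_{\mathcal A}+F_{\mathcal A}^*)$ and $H_{\mathcal B}:=\operatorname{Re}F_{\mathcal B}$ be the corresponding noncommutative harmonic functions, and suppose that $$H_{\mathcal A}(X_1,\dots,X_n)\le H_{\mathcal B}(X_1,\dots,X_n)$$ for every Hilbert space $\mathcal X$ and every $(X_1,\dots,X_n)\in[B(\mathcal X)^n]_{<1}$. Then $$\sum_{|\alpha|=k}(B_{(\alpha)}-A_{(\alpha)})^*(B_{(\alpha)}-A_{(\alpha)})\le\|B_{(0)}-A_{(0)}\|\,(B_{(0)}-A_{(0)})\qquad(k=1,2,\dots),$$ and for every $r\in[0,\frac13]$ both series below converge and $$\sum_{k=1}^\infty r^k\Big\|\sum_{|\alpha|=k}A_{(\alpha)}^*A_{(\alpha)}\Big\|^{1/2}\le\tfrac12\|B_{(0)}-A_{(0)}\|+\sum_{k=1}^\infty r^k\Big\|\sum_{|\alpha|=k}B_{(\alpha)}^*B_{(\alpha)}\Big\|^{1/2}.$$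 -/

import Mathlib

universe u v

noncomputable section

namespace NCHarmonic

open Filter Topology
open scoped TensorProduct ComplexStarModule

/-- The words of length `k` in the unital free semigroup on `n` generators. -/
def words (n k : ℕ) : Finset (FreeMonoid (Fin n)) :=
  Finset.univ.map
    ⟨fun w : Fin k → Fin n => FreeMonoid.ofList (List.ofFn w),
      fun _ _ h => List.ofFn_injective (FreeMonoid.ofList.injective h)⟩

theorem mem_words {n k : ℕ} {α : FreeMonoid (Fin n)} : α ∈ words n k ↔ α.length = k := by
  simp only [words, Finset.mem_map, Finset.mem_univ, true_and]
  constructor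
  · rintro ⟨w, rfl⟩
    exact List.length_ofFn
  · rintro rfl
    exact ⟨fun i => (FreeMonoid.toList α).get i, List.ofFn_get (FreeMonoid.toList α)⟩

/-- The monomial `X_α = X_{i₁} X_{i₂} ⋯ X_{iₖ}` for `α = g_{i₁} g_{i₂} ⋯ g_{iₖ}`, with the
identity for the empty word. -/
def monomial {n : ℕ} {X : Type*} [NormedAddCommGroup X] [InnerProductSpace ℂ X]
    (T : Fin n → X →L[ℂ] X) (α : FreeMonoid (Fin n)) : X →L[ℂ] X :=
  FreeMonoid.lift T α

/-- The open unit ball of `B(X)ⁿ`: the tuples with `‖X₁X₁* + ⋯ + XₙXₙ*‖ < 1`. -/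
def rowBall (n : ℕ) (X : Type*) [NormedAddCommGroup X] [InnerProductSpace ℂ X]
    [CompleteSpace X] : Set (Fin n → X →L[ℂ] X) :=
  {T | ‖∑ i, T i * ContinuousLinearMap.adjoint (T i)‖ < 1}

/-- The Hilbert space tensor product: the completion of the algebraic tensor product in the
norm of the inner product `⟪x ⊗ h, x' ⊗ h'⟫ = ⟪x, x'⟫ ⟪h, h'⟫`. -/
abbrev HilbertTensor (X H : Type*) [NormedAddCommGroup X] [InnerProductSpace ℂ X]
    [NormedAddCommGroup H] [InnerProductSpace ℂ H] : Type _ :=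
  UniformSpace.Completion (X ⊗[ℂ] H)

/-- The operator `S ⊗ A` on the Hilbert space tensor product. -/
def opTensor {X H : Type*} [NormedAddCommGroup X] [InnerProductSpace ℂ X]
    [NormedAddCommGroup H] [InnerProductSpace ℂ H] (S : X →L[ℂ] X) (A : H →L[ℂ] H) :
    HilbertTensor X H →L[ℂ] HilbertTensor X H :=
  (TensorProduct.mapL S A).completion

theorem opTensor_coe_tmul {X H : Type*} [NormedAddCommGroup X] [InnerProductSpace ℂ X]
    [NormedAddCommGroup H] [InnerProductSpace ℂ H] (S : X →L[ℂ] X) (A : H →L[ℂ] H)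
    (x : X) (h : H) :
    opTensor S A ((x ⊗ₜ[ℂ] h : X ⊗[ℂ] H) : HilbertTensor X H)
      = ((S x ⊗ₜ[ℂ] A h : X ⊗[ℂ] H) : HilbertTensor X H) :=
  UniformSpace.Completion.map_coe (TensorProduct.mapL S A).uniformContinuous _

/-- The partial sum `∑_{k < N} ∑_{|α| = k} X_α ⊗ C_α`. -/
def partialSum {n : ℕ} {X H : Type*} [NormedAddCommGroup X] [InnerProductSpace ℂ X]
    [NormedAddCommGroup H] [InnerProductSpace ℂ H]
    (C : FreeMonoid (Fin n) → H →L[ℂ] H) (T : Fin n → X →L[ℂ] X) (N : ℕ) :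
    HilbertTensor X H →L[ℂ] HilbertTensor X H :=
  ∑ k ∈ Finset.range N, ∑ α ∈ words n k, opTensor (monomial T α) (C α)

/-- The coefficients `C` generate a (universal) holomorphic function on the unit ball: for every
Hilbert space `X` (of the universe `v`) and every tuple in the open unit ball of `B(X)ⁿ`, the
series `∑ₖ ∑_{|α| = k} X_α ⊗ C_α` converges in the operator norm. -/
def IsHolomorphic {n : ℕ} {H : Type u} [NormedAddCommGroup H] [InnerProductSpace ℂ H]
    (C : FreeMonoid (Fin n) → H →L[ℂ] H) : Prop :=
  ∀ (X : Type v) [NormedAddCommGroup X] [InnerProductSpace ℂ X] [CompleteSpace X],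
    ∀ T ∈ rowBall n X, ∃ L : HilbertTensor X H →L[ℂ] HilbertTensor X H,
      Tendsto (partialSum C T) atTop (𝓝 L)

/-- The value `∑ₖ ∑_{|α| = k} X_α ⊗ C_α`, as the limit of the partial sums in operator norm. -/
def eval {n : ℕ} {X H : Type*} [NormedAddCommGroup X] [InnerProductSpace ℂ X]
    [NormedAddCommGroup H] [InnerProductSpace ℂ H]
    (C : FreeMonoid (Fin n) → H →L[ℂ] H) (T : Fin n → X →L[ℂ] X) :
    HilbertTensor X H →L[ℂ] HilbertTensor X H :=
  limUnder atTop (partialSum C T)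

/-- The coefficients of `F(X) = ½ I ⊗ A₀ + ∑_{k ≥ 1} ∑_{|α| = k} X_α ⊗ A_α`. -/
def halved {n : ℕ} {H : Type*} [NormedAddCommGroup H] [InnerProductSpace ℂ H]
    (A : FreeMonoid (Fin n) → H →L[ℂ] H) (α : FreeMonoid (Fin n)) : H →L[ℂ] H :=
  if α.length = 0 then (1 / 2 : ℂ) • A α else A α

/-- `A` is a family of coefficients of a selfadjoint noncommutative harmonic function: `A₀` is
selfadjoint and `½ I ⊗ A₀ + ∑_{k ≥ 1} ∑_{|α| = k} X_α ⊗ A_α` is holomorphic on the unit ball. -/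
structure IsHarmonicFamily {n : ℕ} {H : Type u} [NormedAddCommGroup H] [InnerProductSpace ℂ H]
    [CompleteSpace H] (A : FreeMonoid (Fin n) → H →L[ℂ] H) : Prop where
  selfAdjoint : IsSelfAdjoint (A 1)
  holomorphic : IsHolomorphic.{u, v} (halved A)

/-- The harmonic function `H_A(X) = Re (½ I ⊗ A₀ + ∑_{k ≥ 1} ∑_{|α| = k} X_α ⊗ A_α)`. -/
def harmonicFn {n : ℕ} {X H : Type*} [NormedAddCommGroup X] [InnerProductSpace ℂ X]
    [NormedAddCommGroup H] [InnerProductSpace ℂ H]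
    (A : FreeMonoid (Fin n) → H →L[ℂ] H) (T : Fin n → X →L[ℂ] X) :
    HilbertTensor X H →L[ℂ] HilbertTensor X H :=
  (ℜ (eval (halved A) T) : HilbertTensor X H →L[ℂ] HilbertTensor X H)

/-- The operator `∑_{|α| = k} C_α* C_α`. -/
def columnGram {n : ℕ} {H : Type*} [NormedAddCommGroup H] [InnerProductSpace ℂ H]
    [CompleteSpace H] (C : FreeMonoid (Fin n) → H →L[ℂ] H) (k : ℕ) : H →L[ℂ] H :=
  ∑ α ∈ words n k, ContinuousLinearMap.adjoint (C α) * C α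

end NCHarmonic

end

/-! The hypothesis is tested on one tuple, the scaled left creation operators `r S_i` on the full
Fock space, and on vectors `e_1 ⊗ h + ∑_{|β|=k} e_β ⊗ f_β`. Since `S_α e_δ = e_{αδ}`, only the
coefficients of the empty word and of words of length `k` survive. With `D = B 1 - A 1`, letting `r
→ 1` gives `0 ≤ ½⟪h, D h⟫ + Re ∑ ⟪f_β, (B β - A β) h⟫ + ½ ∑ ⟪f_β, D f_β⟫`
(`re_inner_nonneg_of_harmonicFn_le`). Taking `f_β = -t (B β - A β) h` and optimizing over `t` proves
the Gram inequality (`sum_norm_sq_le_of_harmonicFn_le`).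

The square roots in the second claim are norms of column operators, so the triangle inequality
bounds each `A`-term by the `B`-term plus `r^k ‖D‖`, and `∑_{k ≥ 1} r^k = r / (1 - r) ≤ ½` for `r ≤
1/3`. Summability comes from norm convergence at `r S_i`, tested on `e_1 ⊗ x`. -/

namespace NCHarmonic

open Filter Topology
open scoped TensorProduct ComplexStarModule InnerProductSpace

/-! ### Column operators and their Gram operators -/

section Column

variable {ι H K : Type*} [NormedAddCommGroup H] [InnerProductSpace ℂ H]
  [NormedAddCommGroup K] [InnerProductSpace ℂ K]

/-- The column operator `h ↦ (C α h)_{α ∈ s}` into the Hilbert space direct sum. -/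
noncomputable def column (s : Finset ι) (C : ι → H →L[ℂ] K) :
    H →L[ℂ] PiLp 2 (fun _ : s => K) :=
  ((PiLp.continuousLinearEquiv 2 ℂ (fun _ : s => K)).symm : (s → K) →L[ℂ] PiLp 2 fun _ : s => K) ∘L
    ContinuousLinearMap.pi fun α : s => C α

theorem column_apply (s : Finset ι) (C : ι → H →L[ℂ] K) (h : H) (α : s) :
    column s C h α = C α h := rfl

theorem norm_column_apply_sq (s : Finset ι) (C : ι → H →L[ℂ] K) (h : H) :
    ‖column s C h‖ ^ 2 = ∑ α ∈ s, ‖C α h‖ ^ 2 := by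
  rw [PiLp.norm_sq_eq_of_L2, ← Finset.sum_coe_sort s]
  rfl

theorem column_sub (s : Finset ι) (C D : ι → H →L[ℂ] K) :
    column s (fun α => C α - D α) = column s C - column s D := rfl

theorem norm_column_le {s : Finset ι} {C : ι → H →L[ℂ] K} {c : ℝ} (hc : 0 ≤ c)
    (h : ∀ x, ∑ α ∈ s, ‖C α x‖ ^ 2 ≤ c ^ 2 * ‖x‖ ^ 2) : ‖column s C‖ ≤ c := by
  refine ContinuousLinearMap.opNorm_le_bound _ hc fun x => ?_
  refine le_of_sq_le_sq ?_ (by positivity)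
  rw [norm_column_apply_sq, mul_pow]
  exact h x

variable [CompleteSpace H] [CompleteSpace K]

theorem adjoint_column_comp_self (s : Finset ι) (C : ι → H →L[ℂ] K) :
    ContinuousLinearMap.adjoint (column s C) ∘L column s C =
      ∑ α ∈ s, ContinuousLinearMap.adjoint (C α) ∘L C α := by
  ext h
  refine ext_inner_left ℂ fun g => ?_
  rw [ContinuousLinearMap.comp_apply, ContinuousLinearMap.adjoint_inner_right, PiLp.inner_apply,
    sum_apply, inner_sum, ← Finset.sum_coe_sort s]
  simp [column_apply, ContinuousLinearMap.adjoint_inner_right]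

theorem norm_sum_adjoint_comp_self (s : Finset ι) (C : ι → H →L[ℂ] K) :
    ‖∑ α ∈ s, ContinuousLinearMap.adjoint (C α) ∘L C α‖ = ‖column s C‖ ^ 2 := by
  rw [← adjoint_column_comp_self, ContinuousLinearMap.norm_adjoint_comp_self, sq]

/-- The C*-identity for the column. As a norm, the square root becomes subadditive in the
coefficients. -/
theorem sqrt_norm_columnGram {n : ℕ} (C : FreeMonoid (Fin n) → H →L[ℂ] H) (k : ℕ) :
    Real.sqrt ‖columnGram C k‖ = ‖column (words n k) C‖ := by
  rw [← Real.sqrt_sq (norm_nonneg (column (words n k) C)), ← norm_sum_adjoint_comp_self]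
  rfl

theorem inner_columnGram {n : ℕ} (C : FreeMonoid (Fin n) → H →L[ℂ] H) (k : ℕ) (g h : H) :
    ⟪g, columnGram C k h⟫_ℂ = ∑ α ∈ words n k, ⟪C α g, C α h⟫_ℂ := by
  simp [columnGram, ContinuousLinearMap.adjoint_inner_right]

end Column

/-! ### The Fock space and its creation operators -/

section Fock

variable {n : ℕ}

/-- The full Fock space on `n` generators, as the `ℓ²` space over all words. -/
abbrev Fock (n : ℕ) : Type v := lp (fun _ : ULift.{v} (FreeMonoid (Fin n)) => ℂ) 2

open Classical in
/-- The orthonormal basis vector of the Fock space belonging to a word. -/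
noncomputable def fockVec (α : FreeMonoid (Fin n)) : Fock.{v} n :=
  lp.single 2 (ULift.up α) (1 : ℂ)

theorem inner_fockVec_left (α : FreeMonoid (Fin n)) (x : Fock.{v} n) :
    ⟪fockVec α, x⟫_ℂ = x ⟨α⟩ := by
  classical
  rw [fockVec, lp.inner_single_left]
  simp

open Classical in
theorem inner_fockVec (α β : FreeMonoid (Fin n)) :
    ⟪(fockVec α : Fock.{v} n), fockVec β⟫_ℂ = if α = β then 1 else 0 := by
  rw [inner_fockVec_left, fockVec, lp.single_apply]
  simp [Pi.single_apply]

theorem norm_fockVec (α : FreeMonoid (Fin n)) : ‖(fockVec α : Fock.{v} n)‖ = 1 := by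
  rw [norm_eq_sqrt_re_inner (𝕜 := ℂ), inner_fockVec]
  simp

theorem hasSum_norm_sq_fock (x : Fock.{v} n) : HasSum (fun β => ‖x β‖ ^ 2) (‖x‖ ^ 2) := by
  simpa using lp.hasSum_norm (p := 2) (by norm_num) x

theorem memℓp_comp_mul (i : Fin n) (x : Fock.{v} n) :
    Memℓp (fun β : ULift.{v} (FreeMonoid (Fin n)) => x ⟨FreeMonoid.of i * β.down⟩) 2 := by
  rw [memℓp_gen_iff (by norm_num)]
  have h := (hasSum_norm_sq_fock x).summable.comp_injective
    (i := fun β : ULift.{v} (FreeMonoid (Fin n)) => ⟨FreeMonoid.of i * β.down⟩)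
    (fun a b hab => by
      ext
      exact mul_left_cancel (congrArg ULift.down hab))
  simpa [Function.comp_def] using h

/-- By freeness, `(i, β) ↦ g_i β` is injective, so the left side is a subsum of `∑ ‖x β‖²`. -/
theorem tsum_norm_sq_comp_mul_le (x : Fock.{v} n) :
    ∑ i : Fin n, ∑' β : ULift.{v} (FreeMonoid (Fin n)),
      ‖x ⟨FreeMonoid.of i * β.down⟩‖ ^ 2 ≤ ‖x‖ ^ 2 := by
  have hx := hasSum_norm_sq_fock x
  have hinj : Function.Injective
      (fun p : Fin n × ULift.{v} (FreeMonoid (Fin n)) =>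
        (⟨FreeMonoid.of p.1 * p.2.down⟩ : ULift.{v} (FreeMonoid (Fin n)))) := by
    rintro ⟨i, ⟨a⟩⟩ ⟨j, ⟨b⟩⟩ hab
    have h : i :: FreeMonoid.toList a = j :: FreeMonoid.toList b :=
      congrArg FreeMonoid.toList (congrArg ULift.down hab)
    obtain ⟨rfl, h2⟩ := List.cons.inj h
    rw [FreeMonoid.toList.injective h2]
  have h := tsum_comp_le_tsum_of_inj hx.summable (fun _ => by positivity) hinj
  rw [hx.tsum_eq, (hx.summable.comp_injective hinj).tsum_prod, tsum_fintype] at h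
  exact h

/-- The left annihilation operator `(x_β)_β ↦ (x_{g_i β})_β`. -/
noncomputable def annihilation (i : Fin n) : Fock.{v} n →L[ℂ] Fock.{v} n :=
  LinearMap.mkContinuous
    { toFun := fun x => ⟨_, memℓp_comp_mul i x⟩
      map_add' := fun _ _ => rfl
      map_smul' := fun _ _ => rfl } 1 fun x => by
    rw [one_mul]
    refine le_of_sq_le_sq ?_ (norm_nonneg _)
    rw [← (hasSum_norm_sq_fock _).tsum_eq]
    refine le_trans ?_ (tsum_norm_sq_comp_mul_le x)
    exact Finset.single_le_sum
      (f := fun i => ∑' β : ULift.{v} (FreeMonoid (Fin n)), ‖x ⟨FreeMonoid.of i * β.down⟩‖ ^ 2)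
      (fun _ _ => tsum_nonneg fun _ => by positivity) (Finset.mem_univ i)

theorem annihilation_apply (i : Fin n) (x : Fock.{v} n) (β : ULift.{v} (FreeMonoid (Fin n))) :
    annihilation i x β = x ⟨FreeMonoid.of i * β.down⟩ := rfl

theorem norm_column_annihilation_le :
    ‖column Finset.univ (annihilation : Fin n → Fock.{v} n →L[ℂ] Fock.{v} n)‖ ≤ 1 := by
  refine norm_column_le zero_le_one fun x => ?_
  rw [one_pow, one_mul]
  refine le_trans (le_of_eq (Finset.sum_congr rfl fun i _ => ?_)) (tsum_norm_sq_comp_mul_le x)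
  rw [← (hasSum_norm_sq_fock _).tsum_eq]
  rfl

/-- The left creation operators, scaled by `r`. -/
noncomputable def creation (r : ℝ) (i : Fin n) : Fock.{v} n →L[ℂ] Fock.{v} n :=
  (r : ℂ) • ContinuousLinearMap.adjoint (annihilation i)

/-- The row of creation operators is the adjoint of the column of annihilation operators, which is a
contraction; scaling contributes `r² < 1`. -/
theorem creation_mem_rowBall {r : ℝ} (h0 : 0 ≤ r) (h1 : r < 1) :
    (creation r : Fin n → Fock.{v} n →L[ℂ] Fock.{v} n) ∈ rowBall n (Fock.{v} n) := by
  have h : ∑ i : Fin n, (creation r i : Fock.{v} n →L[ℂ] Fock.{v} n) *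
      ContinuousLinearMap.adjoint (creation r i) =
      ((r : ℂ) ^ 2) • ∑ i : Fin n, ContinuousLinearMap.adjoint (annihilation i) ∘L
        (annihilation i : Fock.{v} n →L[ℂ] Fock.{v} n) := by
    rw [Finset.smul_sum]
    refine Finset.sum_congr rfl fun i _ => ?_
    rw [creation, map_smulₛₗ, ContinuousLinearMap.adjoint_adjoint, Complex.conj_ofReal,
      smul_mul_smul_comm, ← sq]
    rfl
  rw [rowBall, Set.mem_ofPred_eq, h, norm_smul, norm_sum_adjoint_comp_self]
  have h2 := norm_column_annihilation_le.{v} (n := n)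
  have h3 : ‖column Finset.univ (annihilation : Fin n → Fock.{v} n →L[ℂ] Fock.{v} n)‖ ^ 2 ≤ 1 :=
    pow_le_one₀ (norm_nonneg _) h2
  have h4 : ‖(r : ℂ) ^ 2‖ = r ^ 2 := by simp
  rw [h4]
  nlinarith

theorem creation_fockVec (r : ℝ) (i : Fin n) (β : FreeMonoid (Fin n)) :
    creation r i (fockVec β : Fock.{v} n) = (r : ℂ) • fockVec (FreeMonoid.of i * β) := by
  rw [creation, smul_apply]
  congr 1
  refine ext_inner_right ℂ fun x => ?_
  rw [ContinuousLinearMap.adjoint_inner_left, inner_fockVec_left, inner_fockVec_left,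
    annihilation_apply]

theorem monomial_creation_fockVec (r : ℝ) (α β : FreeMonoid (Fin n)) :
    monomial (creation r) α (fockVec β : Fock.{v} n) = (r : ℂ) ^ α.length • fockVec (α * β) := by
  induction α using FreeMonoid.inductionOn' with
  | one => simp [monomial]
  | of_mul i α ih =>
    have h : monomial (creation r : Fin n → Fock.{v} n →L[ℂ] Fock.{v} n) (FreeMonoid.of i * α) =
        creation r i * monomial (creation r) α := by
      simp [monomial]
    rw [h, mul_apply_eq_comp, ih, map_smul, creation_fockVec, smul_smul, mul_assoc,
      FreeMonoid.length_mul, FreeMonoid.length_of, add_comm, pow_succ]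

end Fock

/-! ### Matrix coefficients of the series at the creation operators -/

section Eval

variable {n : ℕ} {H : Type u} [NormedAddCommGroup H] [InnerProductSpace ℂ H]

/-- The elementary tensor `e_α ⊗ h` of a basis vector of the Fock space and a vector of `H`. -/
noncomputable def fockTensor (α : FreeMonoid (Fin n)) (h : H) : HilbertTensor (Fock.{v} n) H :=
  ((fockVec α ⊗ₜ[ℂ] h : Fock.{v} n ⊗[ℂ] H) : HilbertTensor (Fock.{v} n) H)

open Classical in
theorem inner_fockTensor (α β : FreeMonoid (Fin n)) (g h : H) :
    ⟪(fockTensor α g : HilbertTensor (Fock.{v} n) H), fockTensor β h⟫_ℂ =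
      if α = β then ⟪g, h⟫_ℂ else 0 := by
  rw [fockTensor, fockTensor, UniformSpace.Completion.inner_coe, TensorProduct.inner_tmul,
    inner_fockVec]
  split_ifs <;> simp

theorem norm_fockTensor (α : FreeMonoid (Fin n)) (h : H) :
    ‖(fockTensor α h : HilbertTensor (Fock.{v} n) H)‖ = ‖h‖ := by
  rw [fockTensor, UniformSpace.Completion.norm_coe, TensorProduct.norm_tmul, norm_fockVec, one_mul]

theorem opTensor_monomial_fockTensor (r : ℝ) (C : H →L[ℂ] H) (α β : FreeMonoid (Fin n)) (h : H) :
    opTensor (monomial (creation r) α) C (fockTensor β h : HilbertTensor (Fock.{v} n) H) =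
      (r : ℂ) ^ α.length • fockTensor (α * β) (C h) := by
  rw [fockTensor, opTensor_coe_tmul, monomial_creation_fockVec, ← TensorProduct.smul_tmul',
    UniformSpace.Completion.coe_smul, fockTensor]

theorem norm_sum_fockTensor_sq (s : Finset (FreeMonoid (Fin n))) (f : FreeMonoid (Fin n) → H) :
    ‖∑ α ∈ s, (fockTensor α (f α) : HilbertTensor (Fock.{v} n) H)‖ ^ 2 =
      ∑ α ∈ s, ‖f α‖ ^ 2 := by
  classical
  rw [← inner_self_eq_norm_sq (𝕜 := ℂ), sum_inner, map_sum]
  refine Finset.sum_congr rfl fun α hα => ?_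
  rw [inner_sum, Finset.sum_eq_single α]
  · rw [inner_fockTensor, if_pos rfl, inner_self_eq_norm_sq]
  · intro β _ hβ
    rw [inner_fockTensor, if_neg hβ.symm]
  · exact fun h => (h hα).elim

theorem inner_partialSum_fockTensor (C : FreeMonoid (Fin n) → H →L[ℂ] H) (r : ℝ) (N : ℕ)
    (γ δ : FreeMonoid (Fin n)) (g h : H) :
    ⟪(fockTensor γ g : HilbertTensor (Fock.{v} n) H),
      partialSum C (creation r) N (fockTensor δ h)⟫_ℂ =
      ∑ k ∈ Finset.range N, ∑ α ∈ words n k, (r : ℂ) ^ α.length *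
        ⟪(fockTensor γ g : HilbertTensor (Fock.{v} n) H), fockTensor (α * δ) (C α h)⟫_ℂ := by
  simp only [partialSum, sum_apply, inner_sum, opTensor_monomial_fockTensor, inner_smul_right]

variable {C : FreeMonoid (Fin n) → H →L[ℂ] H} {r : ℝ}
  {L : HilbertTensor (Fock.{v} n) H →L[ℂ] HilbertTensor (Fock.{v} n) H}

/-- By right cancellation `α` is the only word carrying `δ` to `γ`, so the matrix coefficient is
constant once the partial sum includes degree `|α|`. -/
theorem inner_limit_fockTensor_of_mul (hL : Tendsto (partialSum C (creation r)) atTop (𝓝 L))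
    {α γ δ : FreeMonoid (Fin n)} (hα : γ = α * δ) (g h : H) :
    ⟪(fockTensor γ g : HilbertTensor (Fock.{v} n) H), L (fockTensor δ h)⟫_ℂ =
      (r : ℂ) ^ α.length * ⟪g, C α h⟫_ℂ := by
  have h1 : Tendsto (fun N => ⟪(fockTensor γ g : HilbertTensor (Fock.{v} n) H),
      partialSum C (creation r) N (fockTensor δ h)⟫_ℂ) atTop
      (𝓝 ⟪(fockTensor γ g : HilbertTensor (Fock.{v} n) H), L (fockTensor δ h)⟫_ℂ) :=
    tendsto_const_nhds.inner (((ContinuousLinearMap.apply ℂ _ _).continuous.tendsto _).comp hL)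
  refine tendsto_nhds_unique h1 (tendsto_const_nhds.congr' ?_)
  filter_upwards [eventually_gt_atTop α.length] with N hN
  classical
  have hz : ∀ β, β ≠ α →
      ⟪(fockTensor γ g : HilbertTensor (Fock.{v} n) H), fockTensor (β * δ) (C β h)⟫_ℂ = 0 := by
    intro β hβ
    rw [inner_fockTensor, if_neg]
    exact fun he => hβ (mul_right_cancel (hα.symm.trans he)).symm
  rw [inner_partialSum_fockTensor, Finset.sum_eq_single α.length,
    Finset.sum_eq_single α, inner_fockTensor, if_pos hα]
  · intro β _ hβ
    rw [hz β hβ, mul_zero]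
  · exact fun hn => (hn (mem_words.2 rfl)).elim
  · refine fun k _ hk => Finset.sum_eq_zero fun β hβ => ?_
    rw [hz β (fun he => hk (by rw [← mem_words.1 hβ, he])), mul_zero]
  · exact fun hn => (hn (Finset.mem_range.2 hN)).elim

theorem inner_limit_fockTensor_of_ne (hL : Tendsto (partialSum C (creation r)) atTop (𝓝 L))
    {γ δ : FreeMonoid (Fin n)} (hne : ∀ α, γ ≠ α * δ) (g h : H) :
    ⟪(fockTensor γ g : HilbertTensor (Fock.{v} n) H), L (fockTensor δ h)⟫_ℂ = 0 := by
  have h1 : Tendsto (fun N => ⟪(fockTensor γ g : HilbertTensor (Fock.{v} n) H),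
      partialSum C (creation r) N (fockTensor δ h)⟫_ℂ) atTop
      (𝓝 ⟪(fockTensor γ g : HilbertTensor (Fock.{v} n) H), L (fockTensor δ h)⟫_ℂ) :=
    tendsto_const_nhds.inner (((ContinuousLinearMap.apply ℂ _ _).continuous.tendsto _).comp hL)
  refine tendsto_nhds_unique h1 (tendsto_const_nhds.congr fun N => ?_)
  classical
  rw [inner_partialSum_fockTensor]
  refine (Finset.sum_eq_zero fun k _ => Finset.sum_eq_zero fun β _ => ?_).symm
  rw [inner_fockTensor, if_neg (hne β), mul_zero]

/-- Left multiplication never shortens a word, so the block from degree `k` to degree `0` vanishes,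
and the block within degree `k` is diagonal. -/
theorem inner_limit_test (hL : Tendsto (partialSum C (creation r)) atTop (𝓝 L)) {k : ℕ}
    (hk : 1 ≤ k) (h : H) (f : FreeMonoid (Fin n) → H) :
    ⟪(fockTensor 1 h : HilbertTensor (Fock.{v} n) H) + ∑ β ∈ words n k, fockTensor β (f β),
      L (fockTensor 1 h + ∑ β ∈ words n k, fockTensor β (f β))⟫_ℂ =
      ⟪h, C 1 h⟫_ℂ + (r : ℂ) ^ k * ∑ β ∈ words n k, ⟪f β, C β h⟫_ℂ +
        ∑ β ∈ words n k, ⟪f β, C 1 (f β)⟫_ℂ := by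
  have h10 : ∀ β ∈ words n k,
      ⟪(fockTensor 1 h : HilbertTensor (Fock.{v} n) H), L (fockTensor β (f β))⟫_ℂ = 0 := by
    intro β hβ
    refine inner_limit_fockTensor_of_ne hL (fun α he => ?_) _ _
    have := congrArg FreeMonoid.length he
    rw [FreeMonoid.length_mul, mem_words.1 hβ, FreeMonoid.length_one] at this
    omega
  have h01 : ∀ β ∈ words n k,
      ⟪(fockTensor β (f β) : HilbertTensor (Fock.{v} n) H), L (fockTensor 1 h)⟫_ℂ =
        (r : ℂ) ^ k * ⟪f β, C β h⟫_ℂ := by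
    intro β hβ
    rw [inner_limit_fockTensor_of_mul hL (mul_one β).symm, mem_words.1 hβ]
  have h11 : ∀ β ∈ words n k, ∑ γ ∈ words n k,
      ⟪(fockTensor β (f β) : HilbertTensor (Fock.{v} n) H), L (fockTensor γ (f γ))⟫_ℂ =
        ⟪f β, C 1 (f β)⟫_ℂ := by
    intro β hβ
    rw [Finset.sum_eq_single β]
    · rw [inner_limit_fockTensor_of_mul hL (one_mul β).symm, FreeMonoid.length_one, pow_zero,
        one_mul]
    · intro γ hγ hne
      refine inner_limit_fockTensor_of_ne hL (fun α he => hne ?_) _ _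
      -- A suffix of full length is the whole word, so `α` is empty.
      have h2 := congrArg FreeMonoid.length he
      rw [FreeMonoid.length_mul, mem_words.1 hβ, mem_words.1 hγ] at h2
      have h3 : α = 1 := FreeMonoid.length_eq_zero.1 (by omega)
      rw [he, h3, one_mul]
    · exact fun hn => (hn hβ).elim
  rw [map_add, map_sum, inner_add_left, inner_add_right, inner_add_right, inner_sum, sum_inner,
    sum_inner, inner_limit_fockTensor_of_mul hL (one_mul 1).symm, Finset.sum_eq_zero h10,
    Finset.sum_congr rfl h01]
  simp only [inner_sum]
  rw [Finset.sum_congr rfl h11, ← Finset.mul_sum, FreeMonoid.length_one, pow_zero, one_mul,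
    add_zero, add_assoc]

theorem IsHolomorphic.tendsto_eval {X : Type v} [NormedAddCommGroup X] [InnerProductSpace ℂ X]
    [CompleteSpace X] {T : Fin n → X →L[ℂ] X} (hC : IsHolomorphic.{u, v} C)
    (hT : T ∈ rowBall n X) : Tendsto (partialSum C T) atTop (𝓝 (eval C T)) :=
  tendsto_nhds_limUnder (hC X T hT)

theorem exists_norm_succ_sub_le {E : Type*} [NormedAddCommGroup E] [NormedSpace ℂ E]
    {P : ℕ → E →L[ℂ] E} {a : E →L[ℂ] E} (h : Tendsto P atTop (𝓝 a)) : ∃ M, ∀ k, ‖P (k + 1) - P k‖ ≤ M := by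
  obtain ⟨M, hM⟩ := ((h.comp (tendsto_add_atTop_nat 1)).sub h).norm.bddAbove_range
  exact ⟨M, fun k => hM (Set.mem_range_self k)⟩

theorem partialSum_succ_sub_fockTensor (C : FreeMonoid (Fin n) → H →L[ℂ] H) (r : ℝ) (k : ℕ)
    (x : H) :
    (partialSum C (creation r) (k + 1) - partialSum C (creation r) k)
      (fockTensor 1 x : HilbertTensor (Fock.{v} n) H) =
      (r : ℂ) ^ k • ∑ α ∈ words n k, fockTensor α (C α x) := by
  rw [partialSum, partialSum, Finset.sum_range_succ, add_sub_cancel_left, sum_apply,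
    Finset.smul_sum]
  refine Finset.sum_congr rfl fun α hα => ?_
  rw [opTensor_monomial_fockTensor, mul_one, mem_words.1 hα]

theorem sum_norm_sq_le_of_norm_partialSum_le {M : ℝ} {k : ℕ} (h0 : 0 ≤ r)
    (hM : ‖(partialSum C (creation r) (k + 1) - partialSum C (creation r) k :
      HilbertTensor (Fock.{v} n) H →L[ℂ] HilbertTensor (Fock.{v} n) H)‖ ≤ M) (x : H) :
    (r ^ k) ^ 2 * ∑ α ∈ words n k, ‖C α x‖ ^ 2 ≤ M ^ 2 * ‖x‖ ^ 2 := by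
  have h2 := ContinuousLinearMap.le_of_opNorm_le _ hM
    (fockTensor 1 x : HilbertTensor (Fock.{v} n) H)
  rw [partialSum_succ_sub_fockTensor, norm_smul, norm_fockTensor, norm_pow, Complex.norm_real,
    Real.norm_of_nonneg h0] at h2
  have h3 := pow_le_pow_left₀ (mul_nonneg (pow_nonneg h0 k) (norm_nonneg _)) h2 2
  rwa [mul_pow, norm_sum_fockTensor_sq, mul_pow] at h3

/-- Increments of a convergent sequence are bounded, and the degree-`k` increment sends `e_1 ⊗ x` to
a vector of norm `r^k ‖column (words n k) C x‖`. -/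
theorem IsHolomorphic.exists_norm_column_le (hC : IsHolomorphic.{u, v} C) (h0 : 0 < r)
    (h1 : r < 1) : ∃ M, ∀ k, r ^ k * ‖column (words n k) C‖ ≤ M := by
  obtain ⟨M, hM⟩ := exists_norm_succ_sub_le
    (hC.tendsto_eval (creation_mem_rowBall.{v} h0.le h1))
  refine ⟨M, fun k => ?_⟩
  have hr : 0 < r ^ k := pow_pos h0 k
  rw [← le_div_iff₀' hr]
  refine norm_column_le (div_nonneg ((norm_nonneg _).trans (hM k)) hr.le) fun x => ?_
  rw [div_pow, div_mul_eq_mul_div, le_div_iff₀' (pow_pos hr 2)]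
  exact sum_norm_sq_le_of_norm_partialSum_le h0.le (hM k) x

theorem IsHolomorphic.summable_column (hC : IsHolomorphic.{u, v} C) (h0 : 0 ≤ r) (h1 : r < 1) :
    Summable fun k => r ^ k * ‖column (words n k) C‖ := by
  -- As in Abel's lemma: boundedness at `s > r` gives geometric domination with ratio `r / s`.
  obtain ⟨s, hrs, hs⟩ := exists_between h1
  have hs0 : 0 < s := h0.trans_lt hrs
  obtain ⟨M, hM⟩ := hC.exists_norm_column_le hs0 hs
  refine Summable.of_nonneg_of_le (fun k => by positivity) (fun k => ?_)
    ((summable_geometric_of_lt_one (div_nonneg h0 hs0.le) ((div_lt_one hs0).2 hrs)).mul_right M)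
  calc r ^ k * ‖column (words n k) C‖ = (r / s) ^ k * (s ^ k * ‖column (words n k) C‖) := by
        rw [← mul_assoc, ← mul_pow, div_mul_cancel₀ _ hs0.ne']
    _ ≤ (r / s) ^ k * M := mul_le_mul_of_nonneg_left (hM k) (by positivity)

end Eval

/-! ### Consequences of the order relation -/

section Comparison

variable {n : ℕ} {H : Type u} [NormedAddCommGroup H] [InnerProductSpace ℂ H]

theorem re_inner_realPart {E : Type*} [NormedAddCommGroup E] [InnerProductSpace ℂ E]
    [CompleteSpace E] (a : E →L[ℂ] E) (x : E) :
    (⟪x, (ℜ a : E →L[ℂ] E) x⟫_ℂ).re = (⟪x, a x⟫_ℂ).re := by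
  have h : (⟪x, (star a) x⟫_ℂ).re = (⟪x, a x⟫_ℂ).re := by
    rw [ContinuousLinearMap.star_eq_adjoint, ContinuousLinearMap.adjoint_inner_right]
    exact inner_re_symm (𝕜 := ℂ) _ _
  have h2 : (⟪x, (ℜ a : E →L[ℂ] E) x⟫_ℂ) = (2⁻¹ : ℝ) * (⟪x, a x⟫_ℂ + ⟪x, (star a) x⟫_ℂ) := by
    rw [realPart_apply_coe, smul_apply, add_apply, ← inner_add_right, inner_smul_right_eq_smul]
    exact Complex.real_smul
  rw [h2, Complex.re_ofReal_mul, Complex.add_re, h]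
  ring

theorem halved_one (A : FreeMonoid (Fin n) → H →L[ℂ] H) : halved A 1 = (1 / 2 : ℂ) • A 1 :=
  if_pos FreeMonoid.length_one

theorem halved_of_mem_words (A : FreeMonoid (Fin n) → H →L[ℂ] H) {k : ℕ} (hk : 1 ≤ k)
    {α : FreeMonoid (Fin n)} (hα : α ∈ words n k) : halved A α = A α :=
  if_neg (by rw [mem_words.1 hα]; omega)

theorem column_halved (A : FreeMonoid (Fin n) → H →L[ℂ] H) {k : ℕ} (hk : 1 ≤ k) :
    column (words n k) (halved A) = column (words n k) A := by
  ext h α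
  rw [column_apply, column_apply, halved_of_mem_words A hk α.2]

theorem re_inner_harmonicFn_test [CompleteSpace H] {A : FreeMonoid (Fin n) → H →L[ℂ] H}
    (hA : IsHarmonicFamily.{u, v} A) {r : ℝ} (h0 : 0 ≤ r) (h1 : r < 1) {k : ℕ} (hk : 1 ≤ k)
    (h : H) (f : FreeMonoid (Fin n) → H) :
    (⟪(fockTensor 1 h : HilbertTensor (Fock.{v} n) H) + ∑ β ∈ words n k, fockTensor β (f β),
      harmonicFn A (creation r) (fockTensor 1 h + ∑ β ∈ words n k, fockTensor β (f β))⟫_ℂ).re =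
      1 / 2 * (⟪h, A 1 h⟫_ℂ).re + r ^ k * ∑ β ∈ words n k, (⟪f β, A β h⟫_ℂ).re +
        1 / 2 * ∑ β ∈ words n k, (⟪f β, A 1 (f β)⟫_ℂ).re := by
  have hhalf : ∀ z : ℂ, (1 / 2 * z).re = 1 / 2 * z.re := fun z => by
    rw [← Complex.re_ofReal_mul]
    norm_num
  rw [harmonicFn, re_inner_realPart, inner_limit_test
    (hA.holomorphic.tendsto_eval (creation_mem_rowBall.{v} h0 h1)) hk, halved_one]
  have hs : ∀ β ∈ words n k, ⟪f β, halved A β h⟫_ℂ = ⟪f β, A β h⟫_ℂ := fun β hβ => by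
    rw [halved_of_mem_words A hk hβ]
  rw [Finset.sum_congr rfl hs]
  simp only [smul_apply, inner_smul_right, ← Finset.mul_sum]
  rw [Complex.add_re, Complex.add_re, hhalf, hhalf, ← Complex.ofReal_pow, Complex.re_ofReal_mul,
    Complex.re_sum, Complex.re_sum]

variable [CompleteSpace H] {A B : FreeMonoid (Fin n) → H →L[ℂ] H}

/-- The tested inequality is polynomial in `r`, so it passes to the limit `r → 1` from the left
although `r = 1` lies outside the range of the hypothesis. -/
theorem re_inner_nonneg_of_harmonicFn_le
    (hA : IsHarmonicFamily.{u, v} A) (hB : IsHarmonicFamily.{u, v} B)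
    (hAB : ∀ (X : Type v) [NormedAddCommGroup X] [InnerProductSpace ℂ X] [CompleteSpace X],
      ∀ T ∈ rowBall n X, harmonicFn A T ≤ harmonicFn B T)
    {k : ℕ} (hk : 1 ≤ k) (h : H) (f : FreeMonoid (Fin n) → H) :
    0 ≤ 1 / 2 * (⟪h, (B 1 - A 1) h⟫_ℂ).re +
      ∑ β ∈ words n k, (⟪f β, (B β - A β) h⟫_ℂ).re +
        1 / 2 * ∑ β ∈ words n k, (⟪f β, (B 1 - A 1) (f β)⟫_ℂ).re := by
  have key : ∀ r : ℝ, 0 ≤ r → r < 1 → 0 ≤ 1 / 2 * (⟪h, (B 1 - A 1) h⟫_ℂ).re +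
      r ^ k * ∑ β ∈ words n k, (⟪f β, (B β - A β) h⟫_ℂ).re +
        1 / 2 * ∑ β ∈ words n k, (⟪f β, (B 1 - A 1) (f β)⟫_ℂ).re := by
    intro r h0 h1
    have hle := hAB (Fock.{v} n) _ (creation_mem_rowBall.{v} h0 h1)
    rw [ContinuousLinearMap.le_def] at hle
    have hpos := hle.re_inner_nonneg_right
      (fockTensor 1 h + ∑ β ∈ words n k, fockTensor β (f β))
    rw [sub_apply, inner_sub_right, RCLike.re_to_complex, Complex.sub_re,
      re_inner_harmonicFn_test hA h0 h1 hk, re_inner_harmonicFn_test hB h0 h1 hk] at hpos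
    simp only [sub_apply, inner_sub_right, Complex.sub_re, Finset.sum_sub_distrib]
    linarith
  have hlim : Tendsto (fun r : ℝ => 1 / 2 * (⟪h, (B 1 - A 1) h⟫_ℂ).re +
      r ^ k * ∑ β ∈ words n k, (⟪f β, (B β - A β) h⟫_ℂ).re +
        1 / 2 * ∑ β ∈ words n k, (⟪f β, (B 1 - A 1) (f β)⟫_ℂ).re) (𝓝[<] 1)
      (𝓝 (1 / 2 * (⟪h, (B 1 - A 1) h⟫_ℂ).re +
      1 ^ k * ∑ β ∈ words n k, (⟪f β, (B β - A β) h⟫_ℂ).re +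
        1 / 2 * ∑ β ∈ words n k, (⟪f β, (B 1 - A 1) (f β)⟫_ℂ).re)) := by
    refine Tendsto.mono_left (Continuous.tendsto ?_ 1) nhdsWithin_le_nhds
    fun_prop
  rw [one_pow, one_mul] at hlim
  refine ge_of_tendsto hlim ?_
  filter_upwards [Ioo_mem_nhdsLT (zero_lt_one (α := ℝ))] with r hr
  exact key r hr.1.le hr.2

theorem sum_norm_sq_le_of_harmonicFn_le
    (hA : IsHarmonicFamily.{u, v} A) (hB : IsHarmonicFamily.{u, v} B)
    (hAB : ∀ (X : Type v) [NormedAddCommGroup X] [InnerProductSpace ℂ X] [CompleteSpace X],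
      ∀ T ∈ rowBall n X, harmonicFn A T ≤ harmonicFn B T)
    {k : ℕ} (hk : 1 ≤ k) (h : H) :
    ∑ β ∈ words n k, ‖(B β - A β) h‖ ^ 2 ≤ ‖B 1 - A 1‖ * (⟪h, (B 1 - A 1) h⟫_ℂ).re := by
  set S := ∑ β ∈ words n k, ‖(B β - A β) h‖ ^ 2 with hS
  set D := B 1 - A 1 with hD
  set d := (⟪h, D h⟫_ℂ).re with hd
  -- Twice the tested inequality at `f β = -t (B β - A β) h`, with the last term bounded through
  -- `‖D‖`.
  have hquad : ∀ t : ℝ, 0 ≤ d - 2 * t * S + t ^ 2 * (‖D‖ * S) := by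
    intro t
    have h1 := re_inner_nonneg_of_harmonicFn_le hA hB hAB hk h
      fun β => ((-t : ℝ) : ℂ) • (B β - A β) h
    have h2 : ∑ β ∈ words n k, (⟪((-t : ℝ) : ℂ) • (B β - A β) h, (B β - A β) h⟫_ℂ).re =
        -t * S := by
      rw [hS, Finset.mul_sum]
      refine Finset.sum_congr rfl fun β _ => ?_
      rw [inner_smul_left, Complex.conj_ofReal, Complex.re_ofReal_mul]
      congr 1
      exact inner_self_eq_norm_sq (𝕜 := ℂ) _
    have h3 : ∑ β ∈ words n k, (⟪((-t : ℝ) : ℂ) • (B β - A β) h,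
        D (((-t : ℝ) : ℂ) • (B β - A β) h)⟫_ℂ).re ≤ t ^ 2 * (‖D‖ * S) := by
      rw [hS, Finset.mul_sum, Finset.mul_sum]
      refine Finset.sum_le_sum fun β _ => ?_
      rw [map_smul, inner_smul_left, inner_smul_right, Complex.conj_ofReal, Complex.re_ofReal_mul,
        Complex.re_ofReal_mul, ← mul_assoc, neg_mul_neg, ← sq]
      refine mul_le_mul_of_nonneg_left ?_ (sq_nonneg t)
      have h4 := (re_inner_le_norm (𝕜 := ℂ) ((B β - A β) h) (D ((B β - A β) h))).trans
        (mul_le_mul_of_nonneg_left (D.le_opNorm _) (norm_nonneg _))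
      refine h4.trans (le_of_eq (by ring))
    rw [h2] at h1
    linarith
  have hS0 : 0 ≤ S := Finset.sum_nonneg fun _ _ => by positivity
  rcases eq_or_lt_of_le (norm_nonneg D) with hz | hp
  · rw [← hz, zero_mul]
    by_contra! hlt
    -- For `D = 0` the expression is affine in `t`; this `t` gives it the value `-1`.
    have := hquad ((d + 1) / (2 * S))
    rw [← hz] at this
    have h5 : 2 * ((d + 1) / (2 * S)) * S = d + 1 := by field_simp
    rw [h5] at this
    linarith
  -- For `S > 0`, `1 / ‖D‖` is the minimizer of the quadratic.
  · have := hquad (1 / ‖D‖)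
    have h5 : d - 2 * (1 / ‖D‖) * S + (1 / ‖D‖) ^ 2 * (‖D‖ * S) = (‖D‖ * d - S) / ‖D‖ := by
      field_simp
      ring
    rw [h5, le_div_iff₀ hp] at this
    linarith

theorem columnGram_sub_le_of_harmonicFn_le
    (hA : IsHarmonicFamily.{u, v} A) (hB : IsHarmonicFamily.{u, v} B)
    (hAB : ∀ (X : Type v) [NormedAddCommGroup X] [InnerProductSpace ℂ X] [CompleteSpace X],
      ∀ T ∈ rowBall n X, harmonicFn A T ≤ harmonicFn B T)
    {k : ℕ} (hk : 1 ≤ k) :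
    columnGram (fun α => B α - A α) k ≤ (‖B 1 - A 1‖ : ℂ) • (B 1 - A 1) := by
  have hD : IsSelfAdjoint (B 1 - A 1) := hB.selfAdjoint.sub hA.selfAdjoint
  have hsa : IsSelfAdjoint
      ((‖B 1 - A 1‖ : ℂ) • (B 1 - A 1) - columnGram (fun α => B α - A α) k) := by
    refine IsSelfAdjoint.sub (IsSelfAdjoint.smul (Complex.conj_ofReal _) hD) ?_
    exact isSelfAdjoint_sum _ fun α _ => IsSelfAdjoint.star_mul_self _
  rw [ContinuousLinearMap.le_def, ContinuousLinearMap.isPositive_def']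
  refine ⟨hsa, fun h => ?_⟩
  rw [ContinuousLinearMap.reApplyInnerSelf_apply, inner_re_symm, sub_apply, inner_sub_right,
    inner_columnGram, smul_apply, inner_smul_right, RCLike.re_to_complex, Complex.sub_re,
    Complex.re_ofReal_mul, Complex.re_sum, sub_nonneg]
  refine le_trans (le_of_eq (Finset.sum_congr rfl fun β _ => ?_))
    (sum_norm_sq_le_of_harmonicFn_le hA hB hAB hk h)
  exact inner_self_eq_norm_sq (𝕜 := ℂ) _

theorem norm_column_sub_le_of_harmonicFn_le
    (hA : IsHarmonicFamily.{u, v} A) (hB : IsHarmonicFamily.{u, v} B)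
    (hAB : ∀ (X : Type v) [NormedAddCommGroup X] [InnerProductSpace ℂ X] [CompleteSpace X],
      ∀ T ∈ rowBall n X, harmonicFn A T ≤ harmonicFn B T)
    {k : ℕ} (hk : 1 ≤ k) :
    ‖column (words n k) fun α => B α - A α‖ ≤ ‖B 1 - A 1‖ := by
  refine norm_column_le (norm_nonneg _) fun h => ?_
  refine (sum_norm_sq_le_of_harmonicFn_le hA hB hAB hk h).trans ?_
  rw [sq, mul_assoc]
  refine mul_le_mul_of_nonneg_left ?_ (norm_nonneg _)
  refine (re_inner_le_norm (𝕜 := ℂ) h ((B 1 - A 1) h)).trans ?_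
  calc ‖h‖ * ‖(B 1 - A 1) h‖ ≤ ‖h‖ * (‖B 1 - A 1‖ * ‖h‖) :=
        mul_le_mul_of_nonneg_left ((B 1 - A 1).le_opNorm h) (norm_nonneg _)
    _ = ‖B 1 - A 1‖ * ‖h‖ ^ 2 := by ring

theorem IsHarmonicFamily.summable_sqrt_columnGram (hA : IsHarmonicFamily.{u, v} A) {r : ℝ}
    (h0 : 0 ≤ r) (h1 : r < 1) :
    Summable fun k : ℕ => r ^ (k + 1) * Real.sqrt ‖columnGram A (k + 1)‖ := by
  refine ((summable_nat_add_iff 1).2 (hA.holomorphic.summable_column h0 h1)).congr fun k => ?_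
  rw [sqrt_norm_columnGram, column_halved A (Nat.le_add_left 1 k)]

end Comparison

end NCHarmonic

/-! ### The main theorem -/

theorem theorem3p1 {n : ℕ} {H : Type u} [NormedAddCommGroup H] [InnerProductSpace ℂ H]
    [CompleteSpace H] (A B : FreeMonoid (Fin n) → H →L[ℂ] H)
    (hA : NCHarmonic.IsHarmonicFamily.{u, v} A) (hB : NCHarmonic.IsHarmonicFamily.{u, v} B)
    (hAB : ∀ (X : Type v) [NormedAddCommGroup X] [InnerProductSpace ℂ X] [CompleteSpace X],
      ∀ T ∈ NCHarmonic.rowBall n X, NCHarmonic.harmonicFn A T ≤ NCHarmonic.harmonicFn B T) :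
    (∀ k : ℕ, 1 ≤ k →
      NCHarmonic.columnGram (fun α => B α - A α) k ≤ (‖B 1 - A 1‖ : ℂ) • (B 1 - A 1)) ∧
    (∀ r : ℝ, 0 ≤ r → r ≤ 1 / 3 →
      Summable (fun k : ℕ => r ^ (k + 1) * Real.sqrt ‖NCHarmonic.columnGram A (k + 1)‖) ∧
      Summable (fun k : ℕ => r ^ (k + 1) * Real.sqrt ‖NCHarmonic.columnGram B (k + 1)‖) ∧
      ∑' k : ℕ, r ^ (k + 1) * Real.sqrt ‖NCHarmonic.columnGram A (k + 1)‖
        ≤ 1 / 2 * ‖B 1 - A 1‖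
          + ∑' k : ℕ, r ^ (k + 1) * Real.sqrt ‖NCHarmonic.columnGram B (k + 1)‖) := by
  refine ⟨fun k hk => NCHarmonic.columnGram_sub_le_of_harmonicFn_le hA hB hAB hk,
    fun r h0 h3 => ?_⟩
  have h1 : r < 1 := by linarith
  have hsA := hA.summable_sqrt_columnGram h0 h1
  have hsB := hB.summable_sqrt_columnGram h0 h1
  refine ⟨hsA, hsB, ?_⟩
  have hgeom : HasSum (fun k : ℕ => r ^ (k + 1) * ‖B 1 - A 1‖)
      (r * (1 - r)⁻¹ * ‖B 1 - A 1‖) := by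
    simpa only [pow_succ'] using
      ((hasSum_geometric_of_lt_one h0 h1).mul_left r).mul_right ‖B 1 - A 1‖
  have hterm : ∀ k : ℕ, r ^ (k + 1) * Real.sqrt ‖NCHarmonic.columnGram A (k + 1)‖ ≤
      r ^ (k + 1) * ‖B 1 - A 1‖ +
        r ^ (k + 1) * Real.sqrt ‖NCHarmonic.columnGram B (k + 1)‖ := by
    intro k
    rw [← mul_add, NCHarmonic.sqrt_norm_columnGram, NCHarmonic.sqrt_norm_columnGram]
    refine mul_le_mul_of_nonneg_left ?_ (pow_nonneg h0 _)
    have h2 := NCHarmonic.norm_column_sub_le_of_harmonicFn_le hA hB hAB (Nat.le_add_left 1 k)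
    rw [NCHarmonic.column_sub] at h2
    refine (norm_le_norm_add_norm_sub' _
      (NCHarmonic.column (NCHarmonic.words n (k + 1)) B)).trans ?_
    rw [norm_sub_rev]
    linarith
  refine (hsA.tsum_le_tsum hterm (hgeom.summable.add hsB)).trans ?_
  rw [hgeom.summable.tsum_add hsB, hgeom.tsum_eq]
  refine add_le_add_left (mul_le_mul_of_nonneg_right ?_ (norm_nonneg _)) _
  -- `r / (1 - r) ≤ 1 / 2` is equivalent to `r ≤ 1 / 3`: this is where the radius comes from.
  rw [← div_eq_mul_inv, div_le_iff₀ (by linarith)]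
  linarith
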